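/- **Valuation property of functional quermassintegrals.** Let $n\ge 1$ and let $B$ be the closed Euclidean unit ball of $\mathbb R^n$. For a compact convex set $K\subset\mathbb R^n$, let $W_0(K),\dots,W_n(K)$ be its quermassintegrals, i.e. the coefficients in $$\mathrm{vol}_n(K+\rho B)=\sum_{i=0}^n\binom ni W_i(K)\,\rho^i\qquad(\rho\ge 0),$$ with $W_i(\emptyset)=0$. Let $\mathcal Q^n$ be the class of functions $f:\mathbb R^n\to[0,+\infty]$ that are not identically zero, quasi-concave (that is, $f((1-\lambda)x_0+\lambda x_1)\ge\min\{f(x_0),f(x_1)\}$ for all $x_0,x_1\in\mathbb R^n$ and $\lambda\in[0,1]$), upper semicontinuous, and satisfy $\lim_{\|x\|\to\infty}f(x)=0$. For $f\in\mathcal Q^n$ and $i=0,\dots,n$ put $$W_i(f)=\int_0^{+\infty}W_i(\{f\ge t\})\,dt\in[0,+\infty].$$ Write $f\vee g$ and $f\wedge g$ for the pointwise maximum and minimum. Let $f,g\in\mathcal Q^n$ be such that $f\vee g\in\mathcal Q^n$. Then $f\wedge g\in\mathcal Q^n$, and for every $i=0,1,\dots,n$, $$W_i(f\wedge g)+W_i(f\vee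 g)=W_i(f)+W_i(g).$$ -/

import Mathlib

open MeasureTheory Set Filter Topology
open scoped ENNReal Pointwise

/-- `SteinerExpansion K W` says that the volume of `K + ρ B`, where `B` is the closed Euclidean unit
ball of `ℝⁿ`, equals `∑_{i=0}^n (n choose i) W_i ρ^i` for every `ρ ≥ 0`. -/
def SteinerExpansion {n : ℕ} (K : Set (EuclideanSpace ℝ (Fin n))) (W : Fin (n + 1) → ℝ) : Prop :=
  ∀ ρ : ℝ, 0 ≤ ρ →
    (volume (K + ρ • Metric.closedBall (0 : EuclideanSpace ℝ (Fin n)) 1)).toReal =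
      ∑ i : Fin (n + 1), (n.choose (i : ℕ) : ℝ) * W i * ρ ^ (i : ℕ)

/-- The coefficients of such an expansion are determined by `K`. -/
theorem SteinerExpansion.unique {n : ℕ} {K : Set (EuclideanSpace ℝ (Fin n))}
    {W W' : Fin (n + 1) → ℝ} (h : SteinerExpansion K W) (h' : SteinerExpansion K W') : W = W' := by
  classical
  let P : (Fin (n + 1) → ℝ) → Polynomial ℝ := fun w =>
    ∑ i : Fin (n + 1), Polynomial.monomial (i : ℕ) ((n.choose (i : ℕ) : ℝ) * w i)
  have hP : P W = P W' := by
    apply Polynomial.eq_of_infinite_eval_eq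
    refine (Set.Ici_infinite (0 : ℝ)).mono ?_
    intro ρ hρ
    simp only [P, Set.mem_ofPred_eq, Polynomial.eval_finsetSum, Polynomial.eval_monomial]
    rw [← h ρ hρ, ← h' ρ hρ]
  funext i
  have hc : ∀ w, (P w).coeff (i : ℕ) = (n.choose (i : ℕ) : ℝ) * w i := by
    intro w
    simp [P, Polynomial.finsetSum_coeff, Polynomial.coeff_monomial, Fin.val_inj]
  have h0 : (n.choose (i : ℕ) : ℝ) ≠ 0 := by
    exact_mod_cast (Nat.choose_pos (Nat.lt_succ_iff.mp i.2)).ne'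
  have := congrArg (fun p => p.coeff (i : ℕ)) hP
  simp only [hc] at this
  exact mul_left_cancel₀ h0 this

open Classical in
/-- The `i`-th quermassintegral `W_i(K)`, for `i = 0, …, n`, of a compact convex set `K` in `ℝⁿ`: the
coefficient `W_i(K)` in the expansion `vol (K + ρ B) = ∑_{i=0}^n (n choose i) W_i(K) ρ^i`, `ρ ≥ 0`.
For the empty set all the coefficients vanish. (A set without such an expansion gets the value `0`;
compact convex sets do have one.) -/
noncomputable def quermassintegral {n : ℕ} (i : Fin (n + 1))
    (K : Set (EuclideanSpace ℝ (Fin n))) : ℝ :=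
  if h : ∃ W : Fin (n + 1) → ℝ, SteinerExpansion K W then h.choose i else 0

/-- The class `𝒬ⁿ` of functions `f : ℝⁿ → [0, ∞]` which are not identically zero, quasi-concave, upper
semicontinuous, and tend to `0` as `‖x‖ → ∞`. -/
structure IsQFunction {n : ℕ} (f : EuclideanSpace ℝ (Fin n) → ℝ≥0∞) : Prop where
  ne_zero : f ≠ 0
  quasiconcave : QuasiconcaveOn ℝ univ f
  upperSemicontinuous : UpperSemicontinuous f
  tendsto_zero : Tendsto f (Bornology.cobounded (EuclideanSpace ℝ (Fin n))) (𝓝 0)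

/-- The `i`-th quermassintegral of a function, `W_i(f) = ∫_0^∞ W_i({f ≥ t}) dt`, with values in
`[0, ∞]`. The quermassintegrals of compact convex sets are nonnegative, so `ENNReal.ofReal` only
changes the type of the integrand. -/
noncomputable def functionalQuermassintegral {n : ℕ} (i : Fin (n + 1))
    (f : EuclideanSpace ℝ (Fin n) → ℝ≥0∞) : ℝ≥0∞ :=
  ∫⁻ t in Ioi (0 : ℝ), ENNReal.ofReal (quermassintegral i {x | ENNReal.ofReal t ≤ f x})

/-!
If `K`, `L` are closed, `K ∪ L` is convex and `C` is convex, then a segment from `K` to `L` meets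
`K ∩ L`, and it follows that `(K ∩ L) + C = (K + C) ∩ (L + C)`. So `K ↦ vol (K + C)` is a valuation
on such pairs for every compact convex `C`. A quermassintegral is a fixed linear combination of the
volumes `vol (K + j B)`, `j = 0, …, n`, because the coefficients of a polynomial of degree at most
`n` are linear in its values at these points. Hence it is a valuation too, and `t ↦ W_i {f ≥ t}` is
measurable, being a combination of monotone functions. The result for functions follows by
integrating over the superlevel sets, as those of `f ⊓ g` and `f ⊔ g` are the intersections and the
unions of those of `f` and `g`.

That parallel volumes are polynomial also comes from the valuation property: applied to a
subdivided segment, it shows that `s ↦ vol (K + s [x, y])` is affine, so that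
`ρ ↦ vol (K + ρ Z)` is a polynomial with nonnegative coefficients for every zonotope `Z`. The ball
is a limit of zonotopes because the average of `x ↦ |⟪x, u⟫|` over `u` in the ball is invariant
under reflections, hence a positive multiple of `‖x‖`.
-/

section AdditiveFunctions

theorem eq_mul_of_nonneg_of_add {G : ℝ → ℝ} (hnonneg : ∀ s, 0 ≤ s → 0 ≤ G s)
    (hadd : ∀ s t, 0 ≤ s → 0 ≤ t → G (s + t) = G s + G t) {s : ℝ} (hs : 0 ≤ s) :
    G s = s * G 1 := by
  have hmul (m : ℕ) {r : ℝ} (hr : 0 ≤ r) : G (m * r) = m * G r := by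
    induction m with
    | zero => simpa using hadd 0 0 le_rfl le_rfl
    | succ k ih =>
      rw [Nat.cast_succ, add_one_mul, hadd _ _ (by positivity) hr, ih, add_one_mul]
  have hnat (m : ℕ) : G m = m * G 1 := by simpa using hmul m zero_le_one
  have hmono {a b : ℝ} (ha : 0 ≤ a) (hab : a ≤ b) : G a ≤ G b := by
    have hsplit := hadd a (b - a) ha (sub_nonneg.2 hab)
    rw [add_sub_cancel] at hsplit
    linarith [hnonneg (b - a) (sub_nonneg.2 hab)]
  have hfloor (m : ℕ) : |(m : ℝ) * (G s - s * G 1)| ≤ G 1 := by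
    have hms : 0 ≤ (m : ℝ) * s := by positivity
    have hlower := hmono (Nat.cast_nonneg _) (Nat.floor_le hms)
    have hupper := hmono hms (Nat.lt_floor_add_one ((m : ℝ) * s)).le
    rw [← Nat.cast_succ] at hupper
    rw [hnat, hmul m hs] at hlower hupper
    rw [Nat.cast_succ] at hupper
    have hG := hnonneg 1 zero_le_one
    have hfloor_le := mul_le_mul_of_nonneg_right (Nat.floor_le hms) hG
    have hlt_floor := mul_le_mul_of_nonneg_right (Nat.lt_floor_add_one ((m : ℝ) * s)).le hG
    rw [abs_le]
    constructor <;> linarith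
  by_contra hne
  obtain ⟨m, hm⟩ := Archimedean.arch (G 1 + 1) (abs_pos.2 (sub_ne_zero.2 hne))
  rw [nsmul_eq_mul] at hm
  have := hfloor m
  rw [abs_mul, Nat.abs_cast] at this
  linarith

end AdditiveFunctions

section Valuation

variable {E : Type*} [AddCommGroup E] [Module ℝ E] [TopologicalSpace E] [ContinuousAdd E]
  [ContinuousSMul ℝ E] {K L C : Set E}

theorem exists_mem_segment_inter_of_convex_union (hK : IsClosed K) (hL : IsClosed L)
    (hKL : Convex ℝ (K ∪ L)) {x y : E} (hx : x ∈ K) (hy : y ∈ L) :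
    ∃ z ∈ segment ℝ x y, z ∈ K ∩ L :=
  isPreconnected_closed_iff.1 (convex_segment x y).isPreconnected K L hK hL
    (hKL.segment_subset (Or.inl hx) (Or.inr hy)) ⟨x, left_mem_segment ℝ x y, hx⟩
    ⟨y, right_mem_segment ℝ x y, hy⟩

theorem inter_add_eq_of_convex_union (hK : IsClosed K) (hL : IsClosed L)
    (hKL : Convex ℝ (K ∪ L)) (hC : Convex ℝ C) : K ∩ L + C = (K + C) ∩ (L + C) := by
  refine subset_antisymm inter_add_subset ?_
  rintro x ⟨⟨k, hk, c, hc, hkc⟩, l, hl, c', hc', hlc'⟩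
  obtain ⟨_, ⟨p, q, hp, hq, hpq, rfl⟩, hz⟩ :=
    exists_mem_segment_inter_of_convex_union hK hL hKL hk hl
  refine ⟨_, hz, _, hC hc hc' hp hq hpq, ?_⟩
  calc p • k + q • l + (p • c + q • c') = p • (k + c) + q • (l + c') := by module
    _ = x := by rw [show k + c = x from hkc, show l + c' = x from hlc', Convex.combo_self hpq]

variable [T2Space E] [MeasurableSpace E] [OpensMeasurableSpace E] (μ : Measure E)
  [IsFiniteMeasureOnCompacts μ]

theorem measureReal_inter_add_add_union_add (hK : IsCompact K) (hL : IsCompact L)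
    (hKL : Convex ℝ (K ∪ L)) (hC : Convex ℝ C) (hC' : IsCompact C) :
    μ.real (K ∩ L + C) + μ.real (K ∪ L + C) = μ.real (K + C) + μ.real (L + C) := by
  rw [inter_add_eq_of_convex_union hK.isClosed hL.isClosed hKL hC, union_add, add_comm]
  exact measureReal_union_add_inter (hL.add hC').measurableSet (hK.add hC').measure_ne_top
    (hL.add hC').measure_ne_top

end Valuation

section Segment

variable {𝕜 E : Type*} [Field 𝕜] [LinearOrder 𝕜] [IsStrictOrderedRing 𝕜] [AddCommGroup E]
  [Module 𝕜 E]

theorem segment_union_segment_of_mem {x y z : E} (hy : y ∈ segment 𝕜 x z) :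
    segment 𝕜 x y ∪ segment 𝕜 y z = segment 𝕜 x z := by
  refine subset_antisymm (union_subset ?_ ?_) ?_
  · exact (convex_segment x z).segment_subset (left_mem_segment 𝕜 x z) hy
  · exact (convex_segment x z).segment_subset hy (right_mem_segment 𝕜 x z)
  · have hline : y ∈ range (AffineMap.lineMap x z : 𝕜 → E) := by
      rw [segment_eq_image_lineMap] at hy
      exact image_subset_range _ _ hy
    rw [← insert_endpoints_openSegment 𝕜 x z, insert_subset_iff, insert_subset_iff]
    refine ⟨Or.inl (left_mem_segment 𝕜 x y), Or.inr (right_mem_segment 𝕜 y z), ?_⟩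
    refine (openSegment_subset_union x z hline).trans (insert_subset ?_ ?_)
    · exact Or.inl (right_mem_segment 𝕜 x y)
    · exact union_subset_union (openSegment_subset_segment 𝕜 x y)
        (openSegment_subset_segment 𝕜 y z)

theorem segment_inter_segment_of_mem {x y z : E} (hy : y ∈ segment 𝕜 x z) :
    segment 𝕜 x y ∩ segment 𝕜 y z = {y} := by
  refine subset_antisymm (fun p hp => ?_) (singleton_subset_iff.2
    ⟨right_mem_segment 𝕜 x y, left_mem_segment 𝕜 y z⟩)
  simp only [mem_inter_iff, mem_segment_iff_wbtw] at hp hy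
  exact (wbtw_swap_left_iff 𝕜 z).1 ⟨hy.trans_left_right hp.1, hp.2⟩

theorem smul_segment (c : 𝕜) (x y : E) : c • segment 𝕜 x y = segment 𝕜 (c • x) (c • y) :=
  image_segment 𝕜 (LinearMap.lsmul 𝕜 E c).toAffineMap x y

theorem smul_add_smul_mem_segment (x y : E) {s t : 𝕜} (hs : 0 ≤ s) (ht : 0 ≤ t) :
    t • x + s • y ∈ segment 𝕜 ((s + t) • x) ((s + t) • y) := by
  rw [← smul_segment, (convex_segment x y).add_smul hs ht, add_comm (t • x)]
  exact add_mem_add (smul_mem_smul_set (right_mem_segment 𝕜 x y))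
    (smul_mem_smul_set (left_mem_segment 𝕜 x y))

end Segment

section SegmentMeasure

theorem measureReal_le_measureReal_add {G : Type*} [AddCommGroup G] [TopologicalSpace G]
    [ContinuousAdd G] [MeasurableSpace G] (μ : Measure G) [IsFiniteMeasureOnCompacts μ]
    [μ.IsAddLeftInvariant] {K L : Set G} (hK : IsCompact K) (hL : IsCompact L)
    (hL' : L.Nonempty) : μ.real K ≤ μ.real (K + L) := by
  obtain ⟨x, hx⟩ := hL'
  calc μ.real K = μ.real (x +ᵥ K) := by rw [measureReal_def, measureReal_def, measure_vadd]
    _ ≤ μ.real (K + L) := measureReal_mono (add_comm L K ▸ vadd_set_subset_add hx)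
        (hK.add hL).measure_ne_top

variable {E : Type*} [AddCommGroup E] [Module ℝ E] [TopologicalSpace E] [IsTopologicalAddGroup E]
  [ContinuousSMul ℝ E]

theorem isCompact_segment (x y : E) : IsCompact (segment ℝ x y) := by
  rw [← convexHull_pair]
  exact (toFinite {x, y}).isCompact_convexHull ℝ

variable [T2Space E] [MeasurableSpace E] [BorelSpace E] (μ : Measure E)
  [IsFiniteMeasureOnCompacts μ] [μ.IsAddLeftInvariant] {K : Set E}

theorem measureReal_add_segment_add_measureReal_add_segment (hK : Convex ℝ K) (hK' : IsCompact K)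
    {x y z : E} (hy : y ∈ segment ℝ x z) :
    μ.real (K + segment ℝ x y) + μ.real (K + segment ℝ y z) =
      μ.real (K + segment ℝ x z) + μ.real K := by
  have hunion := segment_union_segment_of_mem hy
  have hval := measureReal_inter_add_add_union_add μ (isCompact_segment x y)
    (isCompact_segment y z) (hunion ▸ convex_segment x z) hK hK'
  rw [hunion, segment_inter_segment_of_mem hy, singleton_add, image_add_left,
    measureReal_def, measure_preimage_add, ← measureReal_def] at hval
  simp only [add_comm K]
  linarith

theorem measureReal_add_smul_segment (hK : Convex ℝ K) (hK' : IsCompact K) (x y : E)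
    {s : ℝ} (hs : 0 ≤ s) :
    μ.real (K + s • segment ℝ x y) =
      μ.real K + s * (μ.real (K + segment ℝ x y) - μ.real K) := by
  have hlin := eq_mul_of_nonneg_of_add (G := fun r => μ.real (K + r • segment ℝ x y) - μ.real K)
    (fun r _ => sub_nonneg.2 (measureReal_le_measureReal_add μ hK' ((isCompact_segment x y).smul r)
      ⟨_, smul_mem_smul_set (left_mem_segment ℝ x y)⟩)) (fun r t hr ht => ?_) hs
  · rw [one_smul] at hlin
    linarith
  · have hsplit := measureReal_add_segment_add_measureReal_add_segment μ hK hK'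
      (smul_add_smul_mem_segment x y hr ht)
    have hleft : segment ℝ ((r + t) • x) (t • x + r • y) = t • x +ᵥ r • segment ℝ x y := by
      rw [smul_segment, vadd_segment, vadd_eq_add, vadd_eq_add, add_smul, add_comm (r • x)]
    have hright : segment ℝ (t • x + r • y) ((r + t) • y) = r • y +ᵥ t • segment ℝ x y := by
      rw [smul_segment, vadd_segment, vadd_eq_add, vadd_eq_add, add_smul, add_comm (t • x)]
    rw [hleft, hright, ← smul_segment, add_vadd_comm, add_vadd_comm] at hsplit
    simp only [measureReal_def, measure_vadd] at hsplit ⊢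
    linarith

end SegmentMeasure

section Zonotope

variable {E : Type*} [AddCommGroup E] [Module ℝ E]

/-- The zonotope that is the Minkowski sum of the segments `[-u, u]`, for `u` in the list `l`. -/
def zonotope (l : List E) : Set E := (l.map fun u => segment ℝ (-u) u).sum

@[simp]
theorem zonotope_nil : zonotope ([] : List E) = 0 := rfl

@[simp]
theorem zonotope_cons (u : E) (l : List E) :
    zonotope (u :: l) = segment ℝ (-u) u + zonotope l := by simp [zonotope]

theorem convex_zonotope (l : List E) : Convex ℝ (zonotope l) := by
  induction l with
  | nil => exact convex_zero
  | cons u l ih => exact zonotope_cons u l ▸ (convex_segment _ _).add ih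

variable [TopologicalSpace E] [IsTopologicalAddGroup E] [ContinuousSMul ℝ E]

theorem isCompact_zonotope (l : List E) : IsCompact (zonotope l) := by
  induction l with
  | nil => exact isCompact_singleton
  | cons u l ih => exact zonotope_cons u l ▸ (isCompact_segment _ _).add ih

end Zonotope

section SegmentAffine

variable {E : Type*} [AddCommGroup E] [Module ℝ E] [TopologicalSpace E]

/-- A nonnegative functional on compact convex sets that is affine along the dilates of every
segment, as volume is. The point of the notion is that it passes to the increments
`K ↦ Φ (K + [x, y]) - Φ K`, so that it can be iterated over the summands of a zonotope. -/
structure IsSegmentAffine (Φ : Set E → ℝ) : Prop where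
  nonneg {K : Set E} : Convex ℝ K → IsCompact K → 0 ≤ Φ K
  add_smul_segment {K : Set E} : Convex ℝ K → IsCompact K → ∀ (x y : E) {s : ℝ}, 0 ≤ s →
    Φ (K + s • segment ℝ x y) = Φ K + s * (Φ (K + segment ℝ x y) - Φ K)

variable [IsTopologicalAddGroup E] [ContinuousSMul ℝ E]

theorem isSegmentAffine_measureReal [T2Space E] [MeasurableSpace E] [BorelSpace E]
    (μ : Measure E) [IsFiniteMeasureOnCompacts μ] [μ.IsAddLeftInvariant] :
    IsSegmentAffine μ.real where
  nonneg _ _ := measureReal_nonneg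
  add_smul_segment hK hK' x y _ hs := measureReal_add_smul_segment μ hK hK' x y hs

theorem IsSegmentAffine.increment {Φ : Set E → ℝ} (hΦ : IsSegmentAffine Φ) (x y : E) :
    IsSegmentAffine fun K => Φ (K + segment ℝ x y) - Φ K where
  nonneg {K} hK hK' := by
    -- The slope of an affine function that is bounded below on a half-line is nonnegative.
    by_contra! hneg
    obtain ⟨m, hm⟩ := Archimedean.arch (Φ K + 1) (neg_pos.2 hneg)
    rw [nsmul_eq_mul] at hm
    have hline := hΦ.add_smul_segment hK hK' x y m.cast_nonneg
    have hdilate := hΦ.nonneg (hK.add ((convex_segment x y).smul (m : ℝ)))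
      (hK'.add ((isCompact_segment x y).smul (m : ℝ)))
    linarith
  add_smul_segment {K} hK hK' a b s hs := by
    rw [add_right_comm K (s • segment ℝ a b), add_right_comm K (segment ℝ a b),
      hΦ.add_smul_segment hK hK' a b hs, hΦ.add_smul_segment (hK.add (convex_segment x y))
        (hK'.add (isCompact_segment x y)) a b hs]
    ring

open Polynomial in
theorem IsSegmentAffine.exists_polynomial {Φ : Set E → ℝ} (hΦ : IsSegmentAffine Φ) {K : Set E}
    (hK : Convex ℝ K) (hK' : IsCompact K) (l : List E) :
    ∃ p : ℝ[X], (∀ k, 0 ≤ p.coeff k) ∧ ∀ ρ : ℝ, 0 ≤ ρ → Φ (K + ρ • zonotope l) = p.eval ρ := by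
  induction l generalizing Φ with
  | nil =>
    refine ⟨C (Φ K), fun k => ?_, fun ρ _ => by simp⟩
    rw [coeff_C]
    split_ifs
    exacts [hΦ.nonneg hK hK', le_rfl]
  | cons u l ih =>
    obtain ⟨p, hp, hΦp⟩ := ih hΦ
    obtain ⟨q, hq, hΦq⟩ := ih (hΦ.increment (-u) u)
    refine ⟨p + X * q, fun k => ?_, fun ρ hρ => ?_⟩
    · rw [coeff_add]
      refine add_nonneg (hp k) ?_
      cases k with
      | zero => simp
      | succ k => simpa using hq k
    · rw [eval_add, eval_mul, eval_X]
      calc Φ (K + ρ • zonotope (u :: l))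
          = Φ (K + ρ • zonotope l + ρ • segment ℝ (-u) u) := by
            rw [zonotope_cons, smul_add, add_left_comm, add_comm]
        _ = Φ (K + ρ • zonotope l) +
              ρ * (Φ (K + ρ • zonotope l + segment ℝ (-u) u) - Φ (K + ρ • zonotope l)) :=
            hΦ.add_smul_segment (hK.add ((convex_zonotope l).smul ρ))
              (hK'.add ((isCompact_zonotope l).smul ρ)) (-u) u hρ
        _ = p.eval ρ + ρ * q.eval ρ := by rw [hΦq ρ hρ, hΦp ρ hρ]

end SegmentAffine

section Growth

open Polynomial in
theorem natDegree_le_of_eval_isBigO_pow {𝕜 : Type*} [NormedField 𝕜] [LinearOrder 𝕜]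
    [IsStrictOrderedRing 𝕜] [OrderTopology 𝕜] {p : 𝕜[X]} {n : ℕ}
    (h : p.eval =O[atTop] fun x : 𝕜 => x ^ n) : p.natDegree ≤ n := by
  by_contra! hlt
  have hp : p ≠ 0 := ne_zero_of_natDegree_gt hlt
  have hlittle : (fun x : 𝕜 => x ^ n) =o[atTop] p.eval := by
    simpa using isLittleO_atTop_of_degree_lt (P := X ^ n) (Q := p)
      (by rwa [degree_X_pow, coe_lt_degree])
  exact h.not_isLittleO (p.eventually_atTop_not_isRoot hp).frequently hlittle

theorem measureReal_add_smul_isBigO {E : Type*} [NormedAddCommGroup E] [NormedSpace ℝ E]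
    [FiniteDimensional ℝ E] [MeasurableSpace E] [BorelSpace E] (μ : Measure E) [μ.IsAddHaarMeasure]
    {K L : Set E} (hK : Bornology.IsBounded K) (hL : Bornology.IsBounded L) :
    (fun ρ : ℝ => μ.real (K + ρ • L)) =O[atTop] fun ρ => ρ ^ Module.finrank ℝ E := by
  obtain ⟨R, hR⟩ := (hK.union hL).subset_closedBall 0
  rw [union_subset_iff] at hR
  set B := Metric.closedBall (0 : E) R
  have hB : IsCompact B := isCompact_closedBall 0 R
  refine Asymptotics.IsBigO.of_bound (μ.real (B + B)) ?_
  filter_upwards [eventually_ge_atTop 1] with ρ hρ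
  have hρ0 : 0 ≤ ρ := zero_le_one.trans hρ
  have hsub : K + ρ • L ⊆ ρ • (B + B) := by
    rw [smul_add]
    refine add_subset_add (hR.1.trans ?_) (smul_set_mono hR.2)
    exact (balanced_closedBall_zero (𝕜 := ℝ)).subset_smul (hρ.trans (le_abs_self ρ))
  rw [Real.norm_of_nonneg measureReal_nonneg, Real.norm_of_nonneg (by positivity), mul_comm]
  calc μ.real (K + ρ • L) ≤ μ.real (ρ • (B + B)) :=
        measureReal_mono hsub ((hB.add hB).smul ρ).measure_ne_top
    _ = ρ ^ Module.finrank ℝ E * μ.real (B + B) := by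
        rw [measureReal_def, Measure.addHaar_smul_of_nonneg μ hρ0, ENNReal.toReal_mul,
          ENNReal.toReal_ofReal (by positivity), measureReal_def]

open Polynomial in
theorem exists_polynomial_measureReal_add_smul_zonotope {E : Type*} [NormedAddCommGroup E]
    [NormedSpace ℝ E] [FiniteDimensional ℝ E] [MeasurableSpace E] [BorelSpace E] (μ : Measure E)
    [μ.IsAddHaarMeasure] {K : Set E} (hK : Convex ℝ K) (hK' : IsCompact K) (l : List E) :
    ∃ p : ℝ[X], (∀ k, 0 ≤ p.coeff k) ∧ p.natDegree ≤ Module.finrank ℝ E ∧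
      ∀ ρ : ℝ, 0 ≤ ρ → μ.real (K + ρ • zonotope l) = p.eval ρ := by
  obtain ⟨p, hp, heval⟩ := (isSegmentAffine_measureReal μ).exists_polynomial hK hK' l
  refine ⟨p, hp, natDegree_le_of_eval_isBigO_pow ?_, heval⟩
  refine (measureReal_add_smul_isBigO μ hK'.isBounded (isCompact_zonotope l).isBounded).congr'
    ?_ .rfl
  filter_upwards [eventually_ge_atTop 0] with ρ hρ using heval ρ hρ

end Growth

section ZonotopeSupport

variable {E : Type*} [NormedAddCommGroup E] [InnerProductSpace ℝ E]

/-- The support function `x ↦ max {⟪x, z⟫ | z ∈ zonotope l}` of a zonotope, written as the sum of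
the support functions `x ↦ |⟪x, u⟫|` of its summands `[-u, u]`. -/
def zonotopeSupport (l : List E) (x : E) : ℝ := (l.map fun u => |inner ℝ x u|).sum

theorem zonotopeSupport_append (l l' : List E) (x : E) :
    zonotopeSupport (l ++ l') x = zonotopeSupport l x + zonotopeSupport l' x := by
  simp [zonotopeSupport]

theorem zonotopeSupport_map_smul (l : List E) (c : ℝ) (x : E) :
    zonotopeSupport (l.map (c • ·)) x = |c| * zonotopeSupport l x := by
  simp [zonotopeSupport, inner_smul_right, abs_mul, List.sum_map_mul_left, Function.comp_def]

theorem zonotopeSupport_smul (l : List E) (c : ℝ) (x : E) :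
    zonotopeSupport l (c • x) = |c| * zonotopeSupport l x := by
  simp [zonotopeSupport, real_inner_smul_left, abs_mul, List.sum_map_mul_left]

theorem isGreatest_inner_zonotope (l : List E) (x : E) :
    IsGreatest (innerSL ℝ x '' zonotope l) (zonotopeSupport l x) := by
  induction l with
  | nil => simp [zonotopeSupport, ← singleton_zero]
  | cons u l ih =>
    have hsegment : IsGreatest (innerSL ℝ x '' segment ℝ (-u) u) |inner ℝ x u| := by
      have himage := image_segment ℝ ((innerSL ℝ x).toLinearMap.toAffineMap) (-u) u
      simp only [LinearMap.coe_toAffineMap, ContinuousLinearMap.coe_coe, map_neg,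
        innerSL_apply_apply] at himage
      rw [himage, segment_eq_uIcc, abs, sup_comm]
      exact isGreatest_Icc inf_le_sup
    rw [zonotope_cons, image_add]
    exact ⟨add_mem_add hsegment.1 ih.1, add_mem_upperBounds_add hsegment.2 ih.2⟩

theorem zonotope_subset_closedBall {l : List E} {r : ℝ} (hr : 0 ≤ r)
    (h : ∀ x, zonotopeSupport l x ≤ r * ‖x‖) : zonotope l ⊆ Metric.closedBall 0 r := by
  intro z hz
  rw [mem_closedBall_zero_iff]
  have hnorm : ‖z‖ * ‖z‖ ≤ r * ‖z‖ := by
    rw [← real_inner_self_eq_norm_mul_norm]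
    exact ((isGreatest_inner_zonotope l z).2 (mem_image_of_mem _ hz)).trans (h z)
  rcases (norm_nonneg z).eq_or_lt with h0 | h0
  · rwa [← h0]
  · exact le_of_mul_le_mul_right hnorm h0

theorem closedBall_subset_zonotope [CompleteSpace E] {l : List E} {r : ℝ}
    (h : ∀ x, r * ‖x‖ ≤ zonotopeSupport l x) : Metric.closedBall 0 r ⊆ zonotope l := by
  intro y hy
  by_contra hyz
  obtain ⟨φ, c, hφ, hc⟩ := geometric_hahn_banach_closed_point (convex_zonotope l)
    (isCompact_zonotope l).isClosed hyz
  obtain ⟨x, rfl⟩ := (InnerProductSpace.toDual ℝ E).surjective φ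
  obtain ⟨z, hz, hzx⟩ := (isGreatest_inner_zonotope l x).1
  refine lt_irrefl c ?_
  calc c < inner ℝ x y := hc
    _ ≤ ‖x‖ * ‖y‖ := real_inner_le_norm x y
    _ ≤ ‖x‖ * r := by gcongr; exact mem_closedBall_zero_iff.1 hy
    _ ≤ zonotopeSupport l x := mul_comm r ‖x‖ ▸ h x
    _ = inner ℝ x z := hzx.symm
    _ < c := hφ z hz

theorem convex_setOf_zonotopeSupport (S : Set E) :
    Convex ℝ {φ : C(S, ℝ) | ∃ l : List E, ∀ x : S, φ x = zonotopeSupport l x} := by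
  rintro φ ⟨l, hl⟩ ψ ⟨l', hl'⟩ a b ha hb -
  refine ⟨l.map (a • ·) ++ l'.map (b • ·), fun x => ?_⟩
  rw [zonotopeSupport_append, zonotopeSupport_map_smul, zonotopeSupport_map_smul,
    abs_of_nonneg ha, abs_of_nonneg hb, ← hl, ← hl']
  rfl

theorem exists_zonotopeSupport_near_setAverage [MeasurableSpace E] [OpensMeasurableSpace E]
    {μ : Measure E} [IsFiniteMeasureOnCompacts μ] {S B : Set E} (hS : IsCompact S)
    (hB : IsCompact B) (hB' : μ B ≠ 0) {δ : ℝ} (hδ : 0 < δ) :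
    ∃ l : List E, ∀ x ∈ S, |zonotopeSupport l x - ⨍ u in B, |inner ℝ x u| ∂μ| < δ := by
  have : CompactSpace S := isCompact_iff_compactSpace.1 hS
  let F : C(E, C(S, ℝ)) := ContinuousMap.curry ⟨fun p => |inner ℝ (p.2 : E) p.1|, by fun_prop⟩
  have hF : IntegrableOn F B μ := F.continuous.continuousOn.integrableOn_compact hB
  have hclosure := (convex_setOf_zonotopeSupport S).set_average_mem_closure hB'
    hB.measure_ne_top (ae_of_all _ fun u => ⟨[u], fun x => by simp [zonotopeSupport, F]⟩) hF
  obtain ⟨φ, ⟨l, hl⟩, hφ⟩ := Metric.mem_closure_iff.1 hclosure δ hδ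
  refine ⟨l, fun x hx => ?_⟩
  have hxφ := (ContinuousMap.dist_apply_le_dist ⟨x, hx⟩).trans_lt hφ
  rwa [hl, setAverage_eq, ContinuousMap.smul_apply, ContinuousMap.integral_apply hF,
    ← setAverage_eq, dist_comm, Real.dist_eq] at hxφ

end ZonotopeSupport

section AverageWidth

variable {E : Type*} [NormedAddCommGroup E] [InnerProductSpace ℝ E] [FiniteDimensional ℝ E]
  [MeasurableSpace E] [BorelSpace E]

theorem setAverage_closedBall_abs_inner_congr {x y : E} (h : ‖x‖ = ‖y‖) (r : ℝ) :
    ⨍ u in Metric.closedBall (0 : E) r, |inner ℝ x u| =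
      ⨍ u in Metric.closedBall (0 : E) r, |inner ℝ y u| := by
  let R := (ℝ ∙ (x - y))ᗮ.reflection
  have hR : R x = y := Submodule.reflection_sub h
  have hpreimage : R ⁻¹' Metric.closedBall 0 r = Metric.closedBall 0 r := by
    rw [R.preimage_closedBall, map_zero]
  have hintegral := (LinearIsometryEquiv.measurePreserving R).setIntegral_preimage_emb
    R.toHomeomorph.measurableEmbedding (fun u => |inner ℝ y u|) (Metric.closedBall 0 r)
  simp only [hpreimage, ← hR, R.inner_map_map] at hintegral
  rw [setAverage_eq, setAverage_eq, hintegral, hR]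

theorem setAverage_closedBall_abs_inner_pos {x : E} (hx : x ≠ 0) {r : ℝ} (hr : 0 < r) :
    0 < ⨍ u in Metric.closedBall (0 : E) r, |inner ℝ x u| := by
  have hcont : Continuous fun u : E => |inner ℝ x u| := by fun_prop
  have hball : 0 < volume.real (Metric.closedBall (0 : E) r) :=
    ENNReal.toReal_pos (Metric.measure_closedBall_pos _ _ hr).ne' measure_closedBall_lt_top.ne
  rw [setAverage_eq, smul_eq_mul]
  refine mul_pos (inv_pos.2 hball) ?_
  rw [setIntegral_pos_iff_support_of_nonneg_ae (ae_of_all _ fun u => abs_nonneg _)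
    (hcont.continuousOn.integrableOn_compact (isCompact_closedBall 0 r))]
  have hopen : IsOpen ((Function.support fun u : E => |inner ℝ x u|) ∩ Metric.ball 0 r) :=
    hcont.isOpen_support.inter Metric.isOpen_ball
  refine (hopen.measure_pos volume ⟨(r / (2 * ‖x‖)) • x, ?_, ?_⟩).trans_le
    (measure_mono (inter_subset_inter_right _ Metric.ball_subset_closedBall))
  · simp [inner_smul_right, hx, hr.ne']
  · have : 0 < ‖x‖ := norm_pos_iff.2 hx
    rw [mem_ball_zero_iff, norm_smul, Real.norm_of_nonneg (by positivity)]
    field_simp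
    norm_num

variable (E) in
theorem exists_setAverage_closedBall_abs_inner_eq_mul_norm :
    ∃ c > 0, ∀ x : E, ⨍ u in Metric.closedBall (0 : E) 1, |inner ℝ x u| = c * ‖x‖ := by
  rcases subsingleton_or_nontrivial E with hE | hE
  · exact ⟨1, one_pos, fun x => by simp [Subsingleton.elim x 0]⟩
  obtain ⟨e, he⟩ := exists_norm_eq E (zero_le_one (α := ℝ))
  refine ⟨⨍ u in Metric.closedBall (0 : E) 1, |inner ℝ e u|,
    setAverage_closedBall_abs_inner_pos (norm_pos_iff.1 (he ▸ one_pos)) one_pos, fun x => ?_⟩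
  have hnorm : ‖x‖ = ‖‖x‖ • e‖ := by rw [norm_smul, norm_norm, he, mul_one]
  rw [setAverage_closedBall_abs_inner_congr hnorm, mul_comm]
  simp only [real_inner_smul_left, abs_mul, abs_norm, setAverage_eq, integral_const_mul,
    smul_eq_mul, mul_left_comm]

end AverageWidth

section BallApproximation

variable (E : Type*) [NormedAddCommGroup E] [InnerProductSpace ℝ E] [FiniteDimensional ℝ E]

theorem exists_zonotopeSupport_near_mul_norm :
    ∃ c > 0, ∀ δ > 0, ∃ l : List E, ∀ x, |zonotopeSupport l x - c * ‖x‖| ≤ δ * ‖x‖ := by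
  borelize E
  obtain ⟨c, hc, haverage⟩ := exists_setAverage_closedBall_abs_inner_eq_mul_norm E
  refine ⟨c, hc, fun δ hδ => ?_⟩
  obtain ⟨l, hl⟩ := exists_zonotopeSupport_near_setAverage (isCompact_sphere (0 : E) 1)
    (isCompact_closedBall 0 1) (Metric.measure_closedBall_pos volume _ one_pos).ne' hδ
  refine ⟨l, fun x => ?_⟩
  rcases eq_or_ne x 0 with rfl | hx
  · simp [zonotopeSupport]
  have hsphere : ‖‖x‖⁻¹ • x‖ = 1 := norm_smul_inv_norm (𝕜 := ℝ) hx
  have hnear := (hl _ (mem_sphere_zero_iff_norm.2 hsphere)).le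
  rw [haverage, hsphere, mul_one] at hnear
  have hscale : zonotopeSupport l x = ‖x‖ * zonotopeSupport l (‖x‖⁻¹ • x) := by
    rw [← abs_norm x, ← zonotopeSupport_smul, abs_norm, smul_inv_smul₀ (norm_ne_zero_iff.2 hx)]
  calc |zonotopeSupport l x - c * ‖x‖| = ‖x‖ * |zonotopeSupport l (‖x‖⁻¹ • x) - c| := by
        rw [hscale, mul_comm c, ← mul_sub, abs_mul, abs_norm]
    _ ≤ δ * ‖x‖ := by rw [mul_comm δ]; gcongr

theorem exists_zonotope_near_closedBall {ε : ℝ} (hε : 0 < ε) : ∃ l : List E,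
    Metric.closedBall 0 1 ⊆ zonotope l ∧ zonotope l ⊆ Metric.closedBall 0 (1 + ε) := by
  obtain ⟨c, hc, hnear⟩ := exists_zonotopeSupport_near_mul_norm E
  -- `δ` is chosen so that `(c + δ) / (c - δ) = 1 + ε`.
  set δ := c * ε / (2 + ε)
  have hδ : 0 < δ := by positivity
  have hcδ : 0 < c - δ := by
    rw [show c - δ = 2 * c / (2 + ε) by simp only [δ]; field_simp; ring]
    positivity
  have hratio : (c - δ) * (1 + ε) = c + δ := by simp only [δ]; field_simp; ring
  obtain ⟨l, hl⟩ := hnear δ hδ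
  refine ⟨l.map ((c - δ)⁻¹ • ·), closedBall_subset_zonotope fun x => ?_,
    zonotope_subset_closedBall (by positivity) fun x => ?_⟩
  all_goals
    have hlx := abs_le.1 (hl x)
    rw [zonotopeSupport_map_smul, abs_of_pos (inv_pos.2 hcδ)]
  · rw [one_mul, le_inv_mul_iff₀ hcδ]
    linarith [hlx.1]
  · rw [inv_mul_le_iff₀ hcδ, ← mul_assoc, hratio]
    linarith [hlx.2]

end BallApproximation

section PolynomialLimits

open Polynomial

theorem exists_coeff_eq_sum_eval (n i : ℕ) : ∃ a : ℕ → ℝ, ∀ p : ℝ[X], p.natDegree ≤ n →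
    p.coeff i = ∑ j ∈ Finset.range (n + 1), a j * p.eval (j : ℝ) := by
  refine ⟨fun j => (Lagrange.basis (Finset.range (n + 1)) (fun k : ℕ => (k : ℝ)) j).coeff i,
    fun p hp => ?_⟩
  have hdeg : p.degree < (Finset.range (n + 1)).card := by
    rw [Finset.card_range]
    exact degree_le_natDegree.trans_lt (by exact_mod_cast Nat.lt_succ_of_le hp)
  conv_lhs => rw [Lagrange.eq_interpolate Nat.cast_injective.injOn hdeg]
  simp only [Lagrange.interpolate_apply, finsetSum_coeff, coeff_C_mul]
  exact Finset.sum_congr rfl fun j _ => mul_comm _ _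

theorem exists_polynomial_eval_of_tendsto {n : ℕ} {p : ℕ → ℝ[X]} {F : ℝ → ℝ}
    (hdeg : ∀ m, (p m).natDegree ≤ n) (hnonneg : ∀ m k, 0 ≤ (p m).coeff k)
    (hlim : ∀ ρ, 0 ≤ ρ → Tendsto (fun m => (p m).eval ρ) atTop (𝓝 (F ρ))) :
    ∃ q : ℝ[X], (∀ k, 0 ≤ q.coeff k) ∧ q.natDegree ≤ n ∧ ∀ ρ, 0 ≤ ρ → F ρ = q.eval ρ := by
  choose a ha using exists_coeff_eq_sum_eval n
  let c (k : ℕ) : ℝ := ∑ j ∈ Finset.range (n + 1), a k j * F j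
  have hcoeff (k : ℕ) : Tendsto (fun m => (p m).coeff k) atTop (𝓝 (c k)) := by
    simp only [ha k _ (hdeg _)]
    exact tendsto_finsetSum _ fun j _ => (hlim j j.cast_nonneg).const_mul _
  have hc (k : ℕ) : 0 ≤ c k := ge_of_tendsto' (hcoeff k) fun m => hnonneg m k
  refine ⟨∑ k ∈ Finset.range (n + 1), monomial k (c k), fun k => ?_, ?_, fun ρ hρ => ?_⟩
  · rw [finsetSum_coeff]
    refine Finset.sum_nonneg fun j _ => ?_
    rw [coeff_monomial]
    split_ifs
    exacts [hc j, le_rfl]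
  · exact natDegree_sum_le_of_forall_le _ _ fun k hk =>
      (natDegree_monomial_le _).trans (Finset.mem_range_succ_iff.1 hk)
  · refine tendsto_nhds_unique (hlim ρ hρ) ?_
    simp only [eval_eq_sum_range' (Nat.lt_succ_of_le (hdeg _)), eval_finsetSum, eval_monomial]
    exact tendsto_finsetSum _ fun k _ => (hcoeff k).mul_const _

end PolynomialLimits

section SteinerFormula

variable {E : Type*} [NormedAddCommGroup E] [MeasurableSpace E] [BorelSpace E]

theorem tendsto_measureReal_add_smul_of_near_closedBall [NormedSpace ℝ E]
    [FiniteDimensional ℝ E] (μ : Measure E) [IsFiniteMeasureOnCompacts μ] {K : Set E}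
    (hK : IsCompact K) {Z : ℕ → Set E} {ε : ℕ → ℝ} (hε : ∀ m, 0 ≤ ε m)
    (hε' : Tendsto ε atTop (𝓝 0)) (hZ : ∀ m, Metric.closedBall 0 1 ⊆ Z m)
    (hZ' : ∀ m, Z m ⊆ Metric.closedBall 0 (1 + ε m)) {ρ : ℝ} (hρ : 0 ≤ ρ) :
    Tendsto (fun m => μ.real (K + ρ • Z m)) atTop
      (𝓝 (μ.real (K + ρ • Metric.closedBall (0 : E) 1))) := by
  have hcompact : IsCompact (K + ρ • Metric.closedBall (0 : E) 1) :=
    hK.add ((isCompact_closedBall _ _).smul ρ)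
  have hthickening : Tendsto (fun m => ρ * ε m) atTop (𝓝 0) := by
    simpa using hε'.const_mul ρ
  refine (ENNReal.tendsto_toReal hcompact.measure_ne_top).comp ?_
  refine tendsto_of_tendsto_of_tendsto_of_le_of_le tendsto_const_nhds
    ((tendsto_measure_cthickening_of_isCompact hcompact).comp hthickening)
    (fun m => measure_mono (add_subset_add_left (smul_set_mono (hZ m))))
    fun m => measure_mono ?_
  have hρε : 0 ≤ ρ * ε m := mul_nonneg hρ (hε m)
  calc K + ρ • Z m ⊆ K + ρ • Metric.closedBall (0 : E) (1 + ε m) :=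
        add_subset_add_left (smul_set_mono (hZ' m))
    _ = K + ρ • Metric.closedBall (0 : E) 1 + Metric.closedBall 0 (ρ * ε m) := by
        rw [smul_closedBall _ _ (add_nonneg zero_le_one (hε m)), smul_zero,
          Real.norm_of_nonneg hρ, smul_unitClosedBall_of_nonneg hρ, add_assoc,
          closedBall_add_closedBall hρ hρε, add_zero, mul_one_add]
    _ = Metric.cthickening (ρ * ε m) (K + ρ • Metric.closedBall (0 : E) 1) :=
        hcompact.add_closedBall_zero hρε

open Polynomial in
theorem exists_polynomial_measureReal_add_smul_closedBall [InnerProductSpace ℝ E]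
    [FiniteDimensional ℝ E] (μ : Measure E) [μ.IsAddHaarMeasure] {K : Set E} (hK : Convex ℝ K)
    (hK' : IsCompact K) :
    ∃ p : ℝ[X], (∀ k, 0 ≤ p.coeff k) ∧ p.natDegree ≤ Module.finrank ℝ E ∧
      ∀ ρ : ℝ, 0 ≤ ρ → μ.real (K + ρ • Metric.closedBall (0 : E) 1) = p.eval ρ := by
  choose l hl hl' using fun m : ℕ =>
    exists_zonotope_near_closedBall E (Nat.one_div_pos_of_nat (α := ℝ) (n := m))
  choose p hnonneg hdeg heval using
    fun m => exists_polynomial_measureReal_add_smul_zonotope μ hK hK' (l m)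
  refine exists_polynomial_eval_of_tendsto hdeg hnonneg fun ρ hρ => ?_
  simp only [← heval _ ρ hρ]
  exact tendsto_measureReal_add_smul_of_near_closedBall μ hK' (fun m => by positivity)
    tendsto_one_div_add_atTop_nhds_zero_nat hl hl' hρ

end SteinerFormula

section Quermassintegral

variable {n : ℕ} {K L : Set (EuclideanSpace ℝ (Fin n))}

theorem SteinerExpansion.quermassintegral_eq {W : Fin (n + 1) → ℝ} (h : SteinerExpansion K W)
    (i : Fin (n + 1)) : quermassintegral i K = W i := by
  have hexists : ∃ W, SteinerExpansion K W := ⟨W, h⟩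
  rw [quermassintegral, dif_pos hexists, hexists.choose_spec.unique h]

open Polynomial in
theorem steinerExpansion_of_polynomial {p : ℝ[X]} (hdeg : p.natDegree ≤ n)
    (heval : ∀ ρ : ℝ, 0 ≤ ρ →
      volume.real (K + ρ • Metric.closedBall (0 : EuclideanSpace ℝ (Fin n)) 1) = p.eval ρ) :
    SteinerExpansion K fun i => p.coeff i / n.choose i := by
  intro ρ hρ
  rw [← measureReal_def, heval ρ hρ, eval_eq_sum_range' (Nat.lt_succ_of_le hdeg),
    Finset.sum_range]
  refine Finset.sum_congr rfl fun i _ => ?_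
  have hchoose : (n.choose i : ℝ) ≠ 0 :=
    Nat.cast_ne_zero.2 (Nat.choose_pos (Nat.lt_succ_iff.1 i.2)).ne'
  rw [mul_div_cancel₀ _ hchoose]

open Polynomial in
theorem exists_polynomial_quermassintegral_eq (hK : Convex ℝ K) (hK' : IsCompact K) :
    ∃ p : ℝ[X], (∀ k, 0 ≤ p.coeff k) ∧ p.natDegree ≤ n ∧
      (∀ ρ : ℝ, 0 ≤ ρ →
        volume.real (K + ρ • Metric.closedBall (0 : EuclideanSpace ℝ (Fin n)) 1) = p.eval ρ) ∧
      ∀ i : Fin (n + 1), quermassintegral i K = p.coeff i / n.choose i := by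
  obtain ⟨p, hnonneg, hdeg, heval⟩ :=
    exists_polynomial_measureReal_add_smul_closedBall volume hK hK'
  rw [finrank_euclideanSpace_fin] at hdeg
  exact ⟨p, hnonneg, hdeg, heval, (steinerExpansion_of_polynomial hdeg heval).quermassintegral_eq⟩

theorem quermassintegral_nonneg (hK : Convex ℝ K) (hK' : IsCompact K) (i : Fin (n + 1)) :
    0 ≤ quermassintegral i K := by
  obtain ⟨p, hnonneg, -, -, hcoeff⟩ := exists_polynomial_quermassintegral_eq hK hK'
  exact hcoeff i ▸ div_nonneg (hnonneg i) (Nat.cast_nonneg _)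

theorem exists_quermassintegral_eq_sum (i : Fin (n + 1)) : ∃ a : ℕ → ℝ,
    ∀ {K : Set (EuclideanSpace ℝ (Fin n))}, Convex ℝ K → IsCompact K →
      quermassintegral i K = ∑ j ∈ Finset.range (n + 1),
        a j * volume.real (K + (j : ℝ) • Metric.closedBall (0 : EuclideanSpace ℝ (Fin n)) 1) := by
  obtain ⟨a, ha⟩ := exists_coeff_eq_sum_eval n i
  refine ⟨fun j => a j / n.choose i, fun {K} hK hK' => ?_⟩
  obtain ⟨p, -, hdeg, heval, hcoeff⟩ := exists_polynomial_quermassintegral_eq hK hK'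
  rw [hcoeff, ha p hdeg, Finset.sum_div]
  exact Finset.sum_congr rfl fun j _ => by rw [heval j j.cast_nonneg, div_mul_eq_mul_div]

theorem quermassintegral_inter_add_union (hK : Convex ℝ K) (hK' : IsCompact K)
    (hL : Convex ℝ L) (hL' : IsCompact L) (hKL : Convex ℝ (K ∪ L)) (i : Fin (n + 1)) :
    quermassintegral i (K ∩ L) + quermassintegral i (K ∪ L) =
      quermassintegral i K + quermassintegral i L := by
  obtain ⟨a, ha⟩ := exists_quermassintegral_eq_sum i
  rw [ha hK hK', ha hL hL', ha (hK.inter hL) (hK'.inter hL'), ha hKL (hK'.union hL'),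
    ← Finset.sum_add_distrib, ← Finset.sum_add_distrib]
  refine Finset.sum_congr rfl fun j _ => ?_
  rw [← mul_add, ← mul_add, measureReal_inter_add_add_union_add volume hK' hL' hKL
    ((convex_closedBall 0 1).smul _) ((isCompact_closedBall 0 1).smul _)]

end Quermassintegral

namespace IsQFunction

variable {n : ℕ} {f g : EuclideanSpace ℝ (Fin n) → ℝ≥0∞}

theorem convex_superlevel (hf : IsQFunction f) (t : ℝ≥0∞) : Convex ℝ {x | t ≤ f x} := by
  simpa using hf.quasiconcave t

theorem isCompact_superlevel (hf : IsQFunction f) {t : ℝ≥0∞} (ht : 0 < t) :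
    IsCompact {x | t ≤ f x} := by
  refine Metric.isCompact_of_isClosed_isBounded (hf.upperSemicontinuous.isClosed_preimage t) ?_
  rw [← Bornology.isCobounded_compl_iff]
  filter_upwards [hf.tendsto_zero.eventually_lt_const ht] with x hx using not_le.2 hx

theorem inf (hf : IsQFunction f) (hg : IsQFunction g) (hfg : QuasiconcaveOn ℝ univ (f ⊔ g)) :
    IsQFunction (f ⊓ g) where
  ne_zero hzero := by
    obtain ⟨x, hx⟩ := Function.ne_iff.1 hf.ne_zero
    obtain ⟨y, hy⟩ := Function.ne_iff.1 hg.ne_zero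
    have ht : 0 < f x ⊓ g y := lt_min (pos_iff_ne_zero.2 hx) (pos_iff_ne_zero.2 hy)
    have hunion : Convex ℝ ({z | f x ⊓ g y ≤ f z} ∪ {z | f x ⊓ g y ≤ g z}) := by
      simpa [le_sup_iff, ofPred_or] using hfg (f x ⊓ g y)
    obtain ⟨z, -, hfz, hgz⟩ := exists_mem_segment_inter_of_convex_union
      (hf.isCompact_superlevel ht).isClosed (hg.isCompact_superlevel ht).isClosed hunion
      (mem_ofPred.2 inf_le_left) (mem_ofPred.2 inf_le_right)
    exact (ht.trans_le (le_inf hfz hgz)).ne' (congrFun hzero z)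
  quasiconcave := hf.quasiconcave.inf hg.quasiconcave
  upperSemicontinuous := hf.upperSemicontinuous.inf hg.upperSemicontinuous
  tendsto_zero := tendsto_of_tendsto_of_tendsto_of_le_of_le tendsto_const_nhds hf.tendsto_zero
    (fun _ => zero_le) fun _ => inf_le_left

theorem aemeasurable_quermassintegral (hf : IsQFunction f) (i : Fin (n + 1)) :
    AEMeasurable (fun t : ℝ => ENNReal.ofReal (quermassintegral i {x | ENNReal.ofReal t ≤ f x}))
      (volume.restrict (Ioi 0)) := by
  obtain ⟨a, ha⟩ := exists_quermassintegral_eq_sum i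
  have hparallel (j : ℕ) : Measurable fun t : ℝ => volume.real ({x | ENNReal.ofReal t ≤ f x} +
      (j : ℝ) • Metric.closedBall (0 : EuclideanSpace ℝ (Fin n)) 1) := by
    refine ENNReal.measurable_toReal.comp (Antitone.measurable fun s t hst => ?_)
    exact measure_mono (add_subset_add_right fun x hx => (ENNReal.ofReal_le_ofReal hst).trans hx)
  have hsum := Finset.measurable_fun_sum (Finset.range (n + 1)) fun j _ =>
    (hparallel j).const_mul (a j)
  refine hsum.ennreal_ofReal.aemeasurable.congr ?_
  filter_upwards [ae_restrict_mem measurableSet_Ioi] with t ht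
  rw [ha (hf.convex_superlevel _) (hf.isCompact_superlevel (ENNReal.ofReal_pos.2 ht))]

end IsQFunction

theorem proposition5p6 (n : ℕ) (f g : EuclideanSpace ℝ (Fin n) → ℝ≥0∞)
    (hf : IsQFunction f) (hg : IsQFunction g) (hfg : IsQFunction (f ⊔ g)) :
    IsQFunction (f ⊓ g) ∧
      ∀ i : Fin (n + 1),
        functionalQuermassintegral i (f ⊓ g) + functionalQuermassintegral i (f ⊔ g) =
          functionalQuermassintegral i f + functionalQuermassintegral i g := by
  have hinf := hf.inf hg hfg.quasiconcave
  refine ⟨hinf, fun i => ?_⟩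
  simp only [functionalQuermassintegral]
  rw [← lintegral_add_left' (hinf.aemeasurable_quermassintegral i),
    ← lintegral_add_left' (hf.aemeasurable_quermassintegral i)]
  refine setLIntegral_congr_fun measurableSet_Ioi fun t ht => ?_
  have ht' : 0 < ENNReal.ofReal t := ENNReal.ofReal_pos.2 ht
  have hnonneg {φ : EuclideanSpace ℝ (Fin n) → ℝ≥0∞} (hφ : IsQFunction φ) :
      0 ≤ quermassintegral i {x | ENNReal.ofReal t ≤ φ x} :=
    quermassintegral_nonneg (hφ.convex_superlevel _) (hφ.isCompact_superlevel ht') i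
  have hunion := hfg.convex_superlevel (ENNReal.ofReal t)
  rw [← ENNReal.ofReal_add (hnonneg hinf) (hnonneg hfg),
    ← ENNReal.ofReal_add (hnonneg hf) (hnonneg hg)]
  simp only [Pi.sup_apply, Pi.inf_apply, le_sup_iff, le_inf_iff, ofPred_or, ofPred_and] at hunion ⊢
  rw [quermassintegral_inter_add_union (hf.convex_superlevel _) (hf.isCompact_superlevel ht')
    (hg.convex_superlevel _) (hg.isCompact_superlevel ht') hunion]
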